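/- Let $T$ be a complete first-order theory with infinite models in a countable language, and assume that $T$ is $\omega$-categorical. Let $\mathfrak C$ be a monster model of $T$: a $\kappa$-saturated and strongly $\kappa$-homogeneous model of $T$ for some uncountable strong limit cardinal $\kappa$; "small" means "of cardinality less than $\kappa$". A hyperimaginary is a class $b_E$, where $b$ is a tuple of small length from $\mathfrak C$ and $E$ is an equivalence relation on tuples of that length which is type-definable over $\emptyset$; it is an imaginary, i.e. an element of $\mathfrak C^{eq}$, if $b$ is finite and $E$ is definable over $\emptyset$. For a set $B$ of hyperimaginaries, $\mathrm{bdd}(B)$ is the set of all hyperimaginaries whose orbit under $\mathrm{Aut}(\mathfrak C/B)$, the group of automorphisms of $\mathfrak C$ that fix each element of $B$, is small. Let $a$ be a finite tuple from $\mathfrak C^{eq}$ and let $A$ be an arbitrary small set of hyperimaginaries (for instance, of elements of $\mathfrak C^{eq}$). Then there is some $e\in\mathfrak C^{eq}$ such that $$\mathrm{bdd}(e)=\mathrm{bdd}(a)\cap\mathrm{bdd}(A).$$ -/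

import Mathlib

open FirstOrder Cardinal

universe u v w

namespace BddClosure

/-- A structure `M` is `κ`-saturated: every set of formulas in one variable, over a set of fewer
than `κ` parameters, which is finitely satisfiable in `M` is realized in `M`. -/
def IsSaturated (L : FirstOrder.Language.{u, v}) (M : Type w) [L.Structure M] (κ : Cardinal.{w}) : Prop :=
  ∀ B : Set M, #B < κ → ∀ p : Set (L[[B]].Formula (Fin 1)),
    (∀ q : Finset (L[[B]].Formula (Fin 1)), (q : Set (L[[B]].Formula (Fin 1))) ⊆ p →
      ∃ x : Fin 1 → M, ∀ φ ∈ q, φ.Realize x) →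
    ∃ x : Fin 1 → M, ∀ φ ∈ p, φ.Realize x

/-- A structure `M` is strongly `κ`-homogeneous: two tuples of the same length less than `κ` and of
the same type over `∅` are conjugate under an automorphism of `M`. -/
def IsStronglyHomogeneous (L : FirstOrder.Language.{u, v}) (M : Type w) [L.Structure M]
    (κ : Cardinal.{w}) : Prop :=
  ∀ (ι : Type w), #ι < κ → ∀ a b : ι → M,
    (∀ φ : L.Formula ι, φ.Realize a ↔ φ.Realize b) → ∃ f : M ≃[L] M, ⇑f ∘ a = b

/-- `M` is a monster model, where "small" (or "bounded") means "of cardinality less than `κ`". -/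
structure IsMonster (L : FirstOrder.Language.{u, v}) (M : Type w) [L.Structure M] (κ : Cardinal.{w}) :
    Prop where
  aleph0_lt : ℵ₀ < κ
  isStrongLimit : κ.IsStrongLimit
  saturated : IsSaturated L M κ
  homogeneous : IsStronglyHomogeneous L M κ

/-- The graph of a binary relation on `ι`-tuples, as a set of `(ι ⊕ ι)`-tuples. -/
def pairSet {M : Type w} {ι : Type w} (r : (ι → M) → (ι → M) → Prop) : Set (ι ⊕ ι → M) :=
  {v | r (v ∘ Sum.inl) (v ∘ Sum.inr)}

/-- A set of tuples is type-definable over `∅`: it is the solution set of a set of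
`L`-formulas without parameters. -/
def IsTypeDefinable (L : FirstOrder.Language.{u, v}) {M : Type w} [L.Structure M] {α : Type w}
    (S : Set (α → M)) : Prop :=
  ∃ Φ : Set (L.Formula α), S = {v | ∀ φ ∈ Φ, φ.Realize v}

/-- A sort of hyperimaginaries: an equivalence relation, type-definable over `∅`, on the tuples of
some fixed small length. -/
structure HyperSort (L : FirstOrder.Language.{u, v}) (M : Type w) [L.Structure M] (κ : Cardinal.{w}) where
  ι : Type w
  small : #ι < κ
  rel : Setoid (ι → M)
  typeDefinable : IsTypeDefinable L (pairSet rel.r)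

/-- A hyperimaginary `a_E`: the class of a small tuple `a` modulo an equivalence relation `E`
which is type-definable over `∅`. -/
structure Hyperimaginary (L : FirstOrder.Language.{u, v}) (M : Type w) [L.Structure M]
    (κ : Cardinal.{w}) where
  sort : HyperSort L M κ
  cls : Quotient sort.rel

variable {L : FirstOrder.Language.{u, v}} {M : Type w} [L.Structure M] {κ : Cardinal.{w}}

theorem HyperSort.rel_comp (S : HyperSort L M κ) (f : M ≃[L] M) {a b : S.ι → M}
    (h : S.rel.r a b) : S.rel.r (⇑f ∘ a) (⇑f ∘ b) := by
  obtain ⟨Φ, hΦ⟩ := S.typeDefinable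
  have key : ∀ x y : S.ι → M, S.rel.r x y ↔ ∀ φ ∈ Φ, φ.Realize (Sum.elim x y) := by
    intro x y
    have h1 : Sum.elim x y ∈ pairSet S.rel.r ↔ S.rel.r x y := Iff.rfl
    rw [← h1, hΦ]
    rfl
  rw [key] at h ⊢
  intro φ hφ
  have h2 := (FirstOrder.Language.StrongHomClass.realize_formula f φ).2 (h φ hφ)
  rwa [Sum.comp_elim] at h2

/-- The action of automorphisms on a sort of hyperimaginaries: `f (a_E) = (f a)_E`. -/
def HyperSort.act (S : HyperSort L M κ) (f : M ≃[L] M) : Quotient S.rel → Quotient S.rel :=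
  Quotient.map (fun a => ⇑f ∘ a) (fun _ _ h => S.rel_comp f h)

/-- The automorphism `f` fixes the hyperimaginary `h`. -/
def Hyperimaginary.FixedBy (h : Hyperimaginary L M κ) (f : M ≃[L] M) : Prop :=
  h.sort.act f h.cls = h.cls

/-- The orbit of the hyperimaginary `h` under the group of automorphisms of `M` which fix every
element of `A`. -/
def Hyperimaginary.orbit (A : Set (Hyperimaginary L M κ)) (h : Hyperimaginary L M κ) :
    Set (Quotient h.sort.rel) :=
  {c | ∃ f : M ≃[L] M, (∀ x ∈ A, x.FixedBy f) ∧ h.sort.act f h.cls = c}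

/-- The bounded closure of `A`: the hyperimaginaries with a small orbit over `A`. -/
def bdd (A : Set (Hyperimaginary L M κ)) : Set (Hyperimaginary L M κ) :=
  {h | #(h.orbit A) < κ}

/-- The elements of `M^eq`: classes of finite tuples modulo equivalence relations that
are definable over `∅`. -/
def Hyperimaginary.IsImaginary (h : Hyperimaginary L M κ) : Prop :=
  Finite h.sort.ι ∧ (∅ : Set M).Definable L (pairSet h.sort.rel.r)

end BddClosure

namespace BddClosure

open FirstOrder.Language Set

variable {L : FirstOrder.Language.{u, v}} {M : Type w} [L.Structure M] {κ : Cardinal.{w}}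

/-! Put C = bdd(a) ∩ bdd(A). For finite B ⊆ C let X_B be the set of tuples representing conjugates
of a over B (`conjTuples`). The plan is to take for e a canonical parameter of the smallest X_B.

X_B is a union of classes of an equivalence relation (`conjSetoid`) invariant over a finite tuple
representing a. Since B ⊆ bdd(a), this relation has fewer than κ classes, hence finitely many by
ω-categoricity and saturation (`InvariantOver.finite_quotient`). Only finitely many relations are
invariant over a given finite tuple (`finite_setOf_invariantOver`), so there are only finitely many
sets X_B. As X_B shrinks when B grows, a minimal one is contained in X_{h} for every h ∈ C
(`exists_least_conjTuples`). It is invariant over a finite tuple, so it has a code e in M^eq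
(`exists_imaginary_code`).

Automorphisms fixing B preserve X_B and so fix e; as B ⊆ C, this puts e in C, and bdd(e) ⊆ C.
Conversely let h ∈ C and let g fix e. Then g⁻¹a represents a point of X_B ⊆ X_{h}, so g⁻¹a = ka for
some k fixing h, and gk fixes a. Thus Aut(M/e) ⊆ Aut(M/a)·Aut(M/h), and h ∈ bdd(a) gives h ∈ bdd(e)
(`SmallIndex.of_factorization`).

The model theory behind this is the Ryll-Nardzewski theorem, proved by omitting types. -/

/-! ### Definable sets of possibly infinite tuples. -/

theorem realize_iff_of_eqOn_freeVar {L : FirstOrder.Language} {M : Type*} [L.Structure M]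
    {α : Type*} [DecidableEq α] (φ : L.Formula α) {x y : α → M}
    (h : ∀ i ∈ φ.freeVarFinset, x i = y i) : φ.Realize x ↔ φ.Realize y := by
  have hx := BoundedFormula.realize_restrictFreeVar' (φ := φ) (s := (φ.freeVarFinset : Set α))
    subset_rfl (v := x) (xs := default)
  have hy := BoundedFormula.realize_restrictFreeVar' (φ := φ) (s := (φ.freeVarFinset : Set α))
    subset_rfl (v := y) (xs := default)
  have hxy : x ∘ ((↑) : ↥(φ.freeVarFinset : Set α) → α) = y ∘ (↑) := funext fun i => h i i.2
  rw [Formula.Realize, Formula.Realize, ← hx, ← hy, hxy]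

theorem exists_support {A : Set M} {α : Type*} {D : Set (α → M)} (hD : A.Definable L D) :
    ∃ s : Finset α, ∀ x y : α → M, (∀ i ∈ s, x i = y i) → x ∈ D → y ∈ D := by
  classical
  obtain ⟨φ, rfl⟩ := hD
  exact ⟨φ.freeVarFinset, fun x y h hx => (realize_iff_of_eqOn_freeVar φ h).1 hx⟩

/-- Projections of definable sets to finitely many coordinates are definable, also for sets of
infinite tuples. -/
theorem definable_image_comp [Nonempty M] {A : Set M} {α β : Type*} [Finite α] {D : Set (β → M)}
    (hD : A.Definable L D) (f : α → β) : A.Definable L ((fun y : β → M => y ∘ f) '' D) := by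
  classical
  obtain ⟨φ, rfl⟩ := hD
  let γ : Set β := (φ.freeVarFinset : Set β) ∪ range f
  have hγ : γ.Finite := φ.freeVarFinset.finite_toSet.union (finite_range f)
  have : Finite γ := hγ
  have hsub : (φ.freeVarFinset : Set β) ⊆ γ := subset_union_left
  let ψ : L[[A]].Formula γ := φ.restrictFreeVar (Set.inclusion hsub)
  have key (y : β → M) : ψ.Realize (y ∘ (↑)) ↔ φ.Realize y :=
    BoundedFormula.realize_restrictFreeVar' hsub
  let f' : α → γ := fun i => ⟨f i, Or.inr ⟨i, rfl⟩⟩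
  have hψ : A.Definable L (Set.ofPred ψ.Realize) := ⟨ψ, rfl⟩
  convert! hψ.image_comp f' using 1
  ext v
  constructor
  · rintro ⟨y, hy, rfl⟩
    exact ⟨y ∘ (↑), (key y).2 hy, rfl⟩
  · rintro ⟨z, hz, rfl⟩
    let y : β → M := fun i => if hi : i ∈ γ then z ⟨i, hi⟩ else Classical.arbitrary M
    have hy : y ∘ ((↑) : γ → β) = z := funext fun i => by simp [y]
    refine ⟨y, (key y).1 (by rw [hy]; exact hz), ?_⟩
    rw [← hy]
    rfl

/-- Fibers of definable sets are definable. -/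
theorem definable_fiber {A B : Set M} {α β : Type*} {D : Set (α ⊕ β → M)}
    (hD : A.Definable L D) (hAB : A ⊆ B) (b : β → M) (hb : range b ⊆ B) :
    B.Definable L {x : α → M | Sum.elim x b ∈ D} := by
  obtain ⟨φ, rfl⟩ := hD.mono hAB
  refine ⟨φ.subst (Sum.elim Term.var fun i => (L.con (⟨b i, hb ⟨i, rfl⟩⟩ : B)).term), ?_⟩
  ext x
  simp only [mem_ofPred_eq, Formula.Realize, BoundedFormula.realize_subst]
  apply iff_of_eq
  congr 1
  funext i
  cases i <;> simp

/-! ### Saturation for finite tuples and sequences. -/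

/-- Saturation, for families of definable sets. -/
theorem IsSaturated.exists_mem (hsat : IsSaturated L M κ) {B : Set M} (hB : #B < κ)
    {F : Set (Set (Fin 1 → M))} (hF : ∀ D ∈ F, B.Definable L D) (hne : F.Nonempty)
    (hdir : ∀ D ∈ F, ∀ D' ∈ F, ∃ D'' ∈ F, D'' ⊆ D ∩ D') (hn : ∀ D ∈ F, D.Nonempty) :
    ∃ x, ∀ D ∈ F, x ∈ D := by
  classical
  obtain ⟨x, hx⟩ := hsat B hB {φ | Set.ofPred φ.Realize ∈ F} (by
    intro q hq
    have : ∃ D ∈ F, ∀ φ ∈ q, ∀ x ∈ D, φ.Realize x := by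
      induction q using Finset.induction_on with
      | empty => exact ⟨_, hne.some_mem, by simp⟩
      | insert φ q _ ih =>
        rw [Finset.coe_insert, insert_subset_iff] at hq
        obtain ⟨D, hD, h⟩ := ih hq.2
        obtain ⟨D', hD', h'⟩ := hdir D hD _ hq.1
        refine ⟨D', hD', fun ψ hψ x hx => ?_⟩
        rcases Finset.mem_insert.1 hψ with rfl | hψ
        · exact (h' hx).2
        · exact h ψ hψ x (h' hx).1
    obtain ⟨D, hD, h⟩ := this
    obtain ⟨x, hx⟩ := hn D hD
    exact ⟨x, fun φ hφ => h φ hφ x hx⟩)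
  refine ⟨x, fun D hD => ?_⟩
  obtain ⟨φ, rfl⟩ := hF D hD
  exact hx φ hD

/-- Saturation, for directed families of definable sets of sequences. -/
theorem IsSaturated.exists_mem_seq [Nonempty M] (hsat : IsSaturated L M κ) (hκ : ℵ₀ < κ) {B : Set M}
    (hB : #B < κ) {F : Set (Set (ℕ → M))} (hF : ∀ D ∈ F, B.Definable L D) (hne : F.Nonempty)
    (hdir : ∀ D ∈ F, ∀ D' ∈ F, ∃ D'' ∈ F, D'' ⊆ D ∩ D') (hn : ∀ D ∈ F, D.Nonempty) :
    ∃ x, ∀ D ∈ F, x ∈ D := by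
  classical
  -- Invariant of the recursion: the first n terms of u extend to a point of each member of F. The
  -- later terms of u are irrelevant.
  let P (n : ℕ) (u : ℕ → M) : Prop := ∀ D ∈ F, ∃ y ∈ D, ∀ i < n, y i = u i
  have step (n : ℕ) (u : ℕ → M) (hu : P n u) :
      ∃ u', P (n + 1) u' ∧ ∀ i < n, u' i = u i := by
    let f : Fin 1 ⊕ Fin n → ℕ := Sum.elim (fun _ => n) (fun i => i)
    let b : Fin n → M := fun i => u i
    let pr (D : Set (ℕ → M)) : Set (Fin 1 → M) :=
      {x | Sum.elim x b ∈ (fun y : ℕ → M => y ∘ f) '' D}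
    have hmem (D : Set (ℕ → M)) (x : Fin 1 → M) :
        x ∈ pr D ↔ ∃ y ∈ D, (∀ i < n, y i = u i) ∧ y n = x 0 := by
      refine exists_congr fun y => and_congr_right fun _ => ?_
      constructor
      · intro h
        exact ⟨fun i hi => congrFun h (Sum.inr ⟨i, hi⟩), congrFun h (Sum.inl 0)⟩
      · rintro ⟨h1, h2⟩
        funext i
        rcases i with i | i
        · rw [Subsingleton.elim i 0]; exact h2
        · exact h1 i i.2
    have hB' : #(B ∪ range b : Set M) < κ :=
      (mk_union_le _ _).trans_lt (add_lt_of_lt hκ.le hB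
        ((lt_aleph0_iff_set_finite.2 (finite_range b)).trans hκ))
    obtain ⟨x, hx⟩ := hsat.exists_mem hB' (F := pr '' F) (by
        rintro _ ⟨D, hD, rfl⟩
        exact definable_fiber (definable_image_comp (hF D hD) f) subset_union_left b
          subset_union_right) (hne.image _) (by
        rintro _ ⟨D, hD, rfl⟩ _ ⟨D', hD', rfl⟩
        obtain ⟨D'', h, hs⟩ := hdir D hD D' hD'
        refine ⟨_, ⟨D'', h, rfl⟩, fun x hx => ?_⟩
        obtain ⟨y, hy, h⟩ := (hmem _ _).1 hx
        exact ⟨(hmem _ _).2 ⟨y, (hs hy).1, h⟩, (hmem _ _).2 ⟨y, (hs hy).2, h⟩⟩) (by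
        rintro _ ⟨D, hD, rfl⟩
        obtain ⟨y, hy, h⟩ := hu D hD
        exact ⟨fun _ => y n, (hmem _ _).2 ⟨y, hy, h, rfl⟩⟩)
    refine ⟨Function.update u n (x 0), fun D hD => ?_, fun i hi => by
      rw [Function.update_of_ne hi.ne]⟩
    obtain ⟨y, hy, h, h'⟩ := (hmem _ _).1 (hx _ ⟨D, hD, rfl⟩)
    refine ⟨y, hy, fun i hi => ?_⟩
    rcases Nat.lt_succ_iff_lt_or_eq.1 hi with hi | rfl
    · rw [Function.update_of_ne hi.ne, h i hi]
    · rw [Function.update_self, h']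
  obtain ⟨D₀, hD₀⟩ := hne
  obtain ⟨y₀, hy₀⟩ := hn D₀ hD₀
  choose! s hs hs' using step
  let U (n : ℕ) : ℕ → M := n.rec y₀ s
  have hU (n : ℕ) : P n (U n) := by
    induction n with
    | zero => exact fun D hD => ⟨_, (hn D hD).some_mem, by simp⟩
    | succ n ih => exact hs n _ ih
  have hU' (n k : ℕ) (i : ℕ) (hi : i < n) : U (n + k) i = U n i := by
    induction k with
    | zero => rfl
    | succ k ih => exact (hs' (n + k) _ (hU _) i (by omega)).trans ih
  -- The diagonal sequence agrees with `U n` below n; each D has finite support, so membership is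
  -- decided at a finite stage.
  refine ⟨fun i => U (i + 1) i, fun D hD => ?_⟩
  obtain ⟨t, ht⟩ := exists_support (hF D hD)
  obtain ⟨y, hy, h⟩ := hU (t.sup id + 1) D hD
  refine ht y _ (fun i hi => ?_) hy
  have hi' : i ≤ t.sup id := Finset.le_sup (f := id) hi
  obtain ⟨k, hk⟩ := Nat.exists_eq_add_of_le hi'
  rw [h i (by omega), hk, show i + k + 1 = i + 1 + k by omega, hU' _ _ _ (by omega)]

/-- Saturation, for families of definable sets of finite tuples with the finite intersection
property. -/
theorem IsSaturated.exists_mem_of_finite (hsat : IsSaturated L M κ) (hκ : ℵ₀ < κ) [Nonempty M]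
    {B : Set M} (hB : #B < κ) {α : Type*} [Finite α] {I : Type*} (D : I → Set (α → M))
    (hD : ∀ i, B.Definable L (D i))
    (hfip : ∀ s : Finset I, ∃ x, ∀ i ∈ s, x ∈ D i) : ∃ x, ∀ i, x ∈ D i := by
  classical
  obtain ⟨e, he⟩ := Countable.exists_injective_nat α
  let D' (s : Finset I) : Set (ℕ → M) := (fun y : ℕ → M => y ∘ e) ⁻¹' ⋂ i ∈ s, D i
  have hD' (s : Finset I) (y : ℕ → M) : y ∈ D' s ↔ ∀ i ∈ s, y ∘ e ∈ D i := by simp [D']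
  obtain ⟨y, hy⟩ := hsat.exists_mem_seq hκ hB (F := range D') (by
      rintro _ ⟨s, rfl⟩
      exact (definable_biInter_finset hD s).preimage_comp e) (range_nonempty _) (by
      rintro _ ⟨s, rfl⟩ _ ⟨t, rfl⟩
      refine ⟨_, ⟨s ∪ t, rfl⟩, fun y hy => ?_⟩
      rw [hD'] at hy
      exact ⟨(hD' _ _).2 fun i hi => hy i (Finset.mem_union_left _ hi),
        (hD' _ _).2 fun i hi => hy i (Finset.mem_union_right _ hi)⟩) (by
      rintro _ ⟨s, rfl⟩
      obtain ⟨x, hx⟩ := hfip s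
      have hex : (Function.extend e x fun _ => Classical.arbitrary M) ∘ e = x :=
        funext fun i => he.extend_apply _ _ i
      refine ⟨Function.extend e x fun _ => Classical.arbitrary M, (hD' _ _).2 ?_⟩
      rw [hex]
      exact hx)
  exact ⟨y ∘ e, fun i => (hD' {i} y).1 (hy _ ⟨{i}, rfl⟩) i (Finset.mem_singleton_self i)⟩

/-! ### Omitting types and the Ryll-Nardzewski theorem. -/

/-- Two tuples have the same complete type over `∅`. -/
def SameType (L : FirstOrder.Language.{u, v}) {M : Type*} [L.Structure M] {α : Type*}
    (x y : α → M) : Prop :=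
  ∀ φ : L.Formula α, φ.Realize x ↔ φ.Realize y

/-- Nonempty `∅`-definable sets of sequences, ordered by reverse inclusion. -/
abbrev SeqCondition (L : FirstOrder.Language.{u, v}) (M : Type w) [L.Structure M] : Type w :=
  {D : Set (ℕ → M) // D.Nonempty ∧ (∅ : Set M).Definable L D}ᵒᵈ

/-- The conditions deciding that `φ` has no solution, or providing a term of the sequence as a
solution of `φ`. -/
def witnessCofinal (φ : L.Formula (ℕ ⊕ Fin 1)) : Order.Cofinal (SeqCondition L M) where
  carrier := {D | (∀ y ∈ (OrderDual.ofDual D).1, ∀ m, ¬ φ.Realize (Sum.elim y m)) ∨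
    ∃ k, ∀ y ∈ (OrderDual.ofDual D).1, φ.Realize (Sum.elim y fun _ => y k)}
  isCofinal := by
    classical
    rintro ⟨D, hne, hD⟩
    by_cases h : ∀ y ∈ D, ∀ m, ¬ φ.Realize (Sum.elim y m)
    · exact ⟨⟨D, hne, hD⟩, Or.inl h, le_rfl⟩
    push Not at h
    obtain ⟨y, hy, m, hm⟩ := h
    obtain ⟨s, hs⟩ := exists_support hD
    -- The coordinate k matters neither to D nor to φ, so it is free to store the witness.
    obtain ⟨k, hk⟩ := Infinite.exists_notMem_finset (s ∪ φ.freeVarFinset.toLeft)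
    rw [Finset.mem_union, not_or] at hk
    let g : ℕ ⊕ Fin 1 → ℕ := Sum.elim id fun _ => k
    have hg (z : ℕ → M) : z ∘ g = Sum.elim z fun _ => z k := by
      funext i
      cases i <;> rfl
    let y' := Function.update y k (m 0)
    have hyy' : ∀ i, i ≠ k → y' i = y i := fun i hi => Function.update_of_ne hi _ _
    refine ⟨⟨D ∩ (fun z : ℕ → M => z ∘ g) ⁻¹' Set.ofPred φ.Realize, ⟨y', ?_, ?_⟩, ?_⟩, ?_, ?_⟩
    · exact hs y y' (fun i hi => (hyy' i fun h => hk.1 (h ▸ hi)).symm) hy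
    · change φ.Realize (y' ∘ g)
      refine (realize_iff_of_eqOn_freeVar φ ?_).1 hm
      rintro (i | i) hi
      · exact (hyy' i fun h => hk.2 (h ▸ Finset.mem_toLeft.2 hi)).symm
      · rw [Subsingleton.elim i 0]
        exact (Function.update_self k (m 0) y).symm
    · exact hD.inter ((empty_definable_iff.2 ⟨φ, rfl⟩).preimage_comp g)
    · refine Or.inr ⟨k, fun z hz => ?_⟩
      rw [← hg]
      exact hz.2
    · exact inter_subset_left

/-- The conditions ensuring that a given finite subsequence does not have the type of `b`. -/
def omitCofinal [Nonempty M] {α : Type*} [Finite α] (b : α → M)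
    (hb : ∀ D : Set (α → M), (∅ : Set M).Definable L D → D.Nonempty → ∃ x ∈ D, ¬ SameType L x b)
    (s : α → ℕ) : Order.Cofinal (SeqCondition L M) where
  carrier := {D | ∀ y ∈ (OrderDual.ofDual D).1, ¬ SameType L (y ∘ s) b}
  isCofinal := by
    rintro ⟨D, hne, hD⟩
    obtain ⟨_, ⟨y, hy, rfl⟩, h⟩ := hb _ (definable_image_comp hD s) (hne.image _)
    rw [SameType, not_forall] at h
    obtain ⟨φ, hφ⟩ := h
    refine ⟨⟨D ∩ (fun z : ℕ → M => z ∘ s) ⁻¹' {z | ¬ (φ.Realize z ↔ φ.Realize b)}, ⟨y, hy, hφ⟩,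
      hD.inter (Definable.preimage_comp s ?_)⟩, fun z hz h => hz.2 (h φ), inter_subset_left⟩
    have hφD : (∅ : Set M).Definable L (Set.ofPred φ.Realize) := empty_definable_iff.2 ⟨φ, rfl⟩
    by_cases h : φ.Realize b
    · simpa [h] using! hφD.compl
    · simpa [h] using! hφD

/-- A sequence generic for countably many cofinal sets of conditions has a range that passes the
Tarski–Vaught test and omits the type of b. By `hb`, no nonempty `∅`-definable set isolates that
type, so omission is cofinal. -/
theorem exists_countable_elementarySubstructure_omitting [Countable L.Symbols] [Nonempty M]
    (hsat : IsSaturated L M κ) (hκ : ℵ₀ < κ) {α : Type*} [Finite α] (b : α → M)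
    (hb : ∀ D : Set (α → M), (∅ : Set M).Definable L D → D.Nonempty →
      ∃ x ∈ D, ¬ SameType L x b) :
    ∃ N : L.ElementarySubstructure M, Countable N ∧
      ∀ x : α → N, ¬ SameType L (fun i => (x i : M)) b := by
  classical
  let 𝒟 : L.Formula (ℕ ⊕ Fin 1) ⊕ (α → ℕ) → Order.Cofinal (SeqCondition L M) :=
    Sum.elim witnessCofinal (omitCofinal b hb)
  have : Encodable (L.Formula (ℕ ⊕ Fin 1) ⊕ (α → ℕ)) := Encodable.ofCountable _
  let p : SeqCondition L M := ⟨univ, univ_nonempty, definable_univ⟩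
  let J := Order.idealOfCofinals p 𝒟
  -- The generic ideal is a directed family of nonempty definable sets; saturation realizes it by an
  -- actual sequence in M.
  obtain ⟨x, hx⟩ := hsat.exists_mem_seq hκ (B := ∅) (by simpa using aleph0_pos.trans hκ)
    (F := {D | ∃ h, (⟨D, h⟩ : SeqCondition L M) ∈ J}) (fun D hD => hD.1.2)
    ⟨univ, p.2, Order.mem_idealOfCofinals p 𝒟⟩ (by
      rintro D ⟨h, hD⟩ D' ⟨h', hD'⟩
      obtain ⟨⟨D'', h''⟩, hJ, h1, h2⟩ := J.directed _ hD _ hD'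
      exact ⟨D'', ⟨h'', hJ⟩, subset_inter h1 h2⟩) (fun D hD => hD.1.1)
  have hwit (φ : L.Formula (ℕ ⊕ Fin 1)) (m : Fin 1 → M) (hm : φ.Realize (Sum.elim x m)) :
      ∃ k, φ.Realize (Sum.elim x fun _ => x k) := by
    obtain ⟨⟨D, h⟩, hD, hJ⟩ := Order.cofinal_meets_idealOfCofinals p 𝒟 (Sum.inl φ)
    have hxD : x ∈ D := hx D ⟨h, hJ⟩
    rcases hD with hD | ⟨k, hD⟩
    · exact absurd hm (hD x hxD m)
    · exact ⟨k, hD x hxD⟩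
  have homit (s : α → ℕ) : ¬ SameType L (x ∘ s) b := by
    obtain ⟨⟨D, h⟩, hD, hJ⟩ := Order.cofinal_meets_idealOfCofinals p 𝒟 (Sum.inr s)
    exact hD x (hx D ⟨h, hJ⟩)
  have hmeets : L.MeetsDefinable (range x) := by
    rintro D ⟨m, hm⟩ hD
    obtain ⟨φ, hφ⟩ := definable_iff_exists_formula_sum.1 hD
    have hφ' (m : M) : m ∈ D ↔ φ.Realize (Sum.elim (↑) fun _ => m) := by
      have : (fun _ => m : Fin 1 → M) ∈ {v : Fin 1 → M | v 0 ∈ D} ↔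
          φ.Realize (Sum.elim (↑) fun _ => m) := by
        rw [hφ]; rfl
      exact this
    let ρ : range x → ℕ := fun a => a.2.choose
    have hρ (a : range x) : x (ρ a) = a := a.2.choose_spec
    have key (m : M) : (φ.relabel (Sum.map ρ id)).Realize (Sum.elim x fun _ => m) ↔ m ∈ D := by
      rw [hφ', Formula.realize_relabel]
      apply iff_of_eq
      congr 1
      funext i
      rcases i with i | i
      · exact hρ i
      · rfl
    obtain ⟨k, hk⟩ := hwit _ _ ((key m).2 hm)
    exact ⟨x k, (key _).1 hk, k, rfl⟩
  have hmem (m : M) : m ∈ hmeets.toElementarySubstructure ↔ m ∈ range x :=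
    iff_of_eq (congrArg (m ∈ ·) hmeets.closure_eq_self)
  refine ⟨hmeets.toElementarySubstructure, ?_, fun y hy => ?_⟩
  · have hc : (hmeets.toElementarySubstructure : Set M) = range x := Set.ext hmem
    have : ((hmeets.toElementarySubstructure : Set M)).Countable := by
      rw [hc]
      exact countable_range x
    exact this.to_subtype
  · have : ∀ i, ∃ k, x k = y i := fun i => (hmem _).1 (y i).2
    choose s hs using this
    exact homit s (by rwa [show x ∘ s = fun i => (y i : M) from funext hs])

/-- Countable infinite models of an `ω`-categorical theory are isomorphic. -/
theorem nonempty_iso_of_countable {T : L.Theory}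
    (hcat : Cardinal.Categorical (ℵ₀ : Cardinal.{0}) T) (N N' : Type w) [L.Structure N]
    [L.Structure N'] [N ⊨ T] [N' ⊨ T] [Countable N] [Countable N'] [Infinite N] [Infinite N'] :
    Nonempty (N ≃[L] N') := by
  -- Categoricity speaks of models in universe 0, so both structures are transported to ℕ.
  obtain ⟨e⟩ := nonempty_equiv_of_countable (α := N) (β := ℕ)
  obtain ⟨e'⟩ := nonempty_equiv_of_countable (α := N') (β := ℕ)
  let K : T.ModelType := (Theory.ModelType.of T N).equivInduced e
  let K' : T.ModelType := (Theory.ModelType.of T N').equivInduced e'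
  obtain ⟨j⟩ := hcat K K' mk_nat mk_nat
  let i : N ≃[L] K := e.inducedStructureEquiv
  let i' : N' ≃[L] K' := e'.inducedStructureEquiv
  exact ⟨i'.symm.comp (j.comp i)⟩

/-- Otherwise some countable elementary substructure omits the type of b, while by Löwenheim–Skolem
another contains b. An isomorphism between them carries b to a realization of the omitted type. -/
theorem exists_isolating (hL : L.card ≤ ℵ₀) [Infinite M] {T : L.Theory} [M ⊨ T]
    (hcat : Cardinal.Categorical (ℵ₀ : Cardinal.{0}) T)
    (hsat : IsSaturated L M κ) (hκ : ℵ₀ < κ) {α : Type*} [Finite α] (b : α → M) :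
    ∃ D : Set (α → M), (∅ : Set M).Definable L D ∧ b ∈ D ∧ ∀ x ∈ D, SameType L x b := by
  have : Countable L.Symbols := mk_le_aleph0_iff.1 hL
  by_contra! h
  obtain ⟨N, hN, hom⟩ := exists_countable_elementarySubstructure_omitting hsat hκ b (by
    intro D hD hne
    by_contra! hb
    obtain ⟨x, hx⟩ := hne
    obtain ⟨φ, rfl⟩ := empty_definable_iff.1 hD
    obtain ⟨y, hy, hy'⟩ := h _ hD ((hb x hx φ).1 hx)
    exact hy' (hb y hy))
  obtain ⟨N', hbN, hN'⟩ := exists_elementarySubstructure_card_eq L (range b)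
    (ℵ₀ : Cardinal.{0}) le_rfl
    (by simp) (by simpa using hL)
    (by simp)
  have : Countable N' := by
    rw [← mk_le_aleph0_iff]
    simpa using hN'.le
  have : Infinite N := N.elementarilyEquivalent.infinite_iff.2 inferInstance
  have : Infinite N' := N'.elementarilyEquivalent.infinite_iff.2 inferInstance
  obtain ⟨j⟩ := nonempty_iso_of_countable hcat N' N
  let c : α → N' := fun i => ⟨b i, hbN ⟨i, rfl⟩⟩
  refine hom (j ∘ c) fun φ => ?_
  calc φ.Realize (fun i => ((j ∘ c) i : M)) ↔ φ.Realize (j ∘ c) :=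
        N.subtype.map_formula φ (j ∘ c)
    _ ↔ φ.Realize c := StrongHomClass.realize_formula j φ
    _ ↔ φ.Realize b := (N'.subtype.map_formula φ c).symm

/-- The Ryll-Nardzewski theorem, inside a saturated model: there are finitely many types of
finite tuples, each of them isolated. -/
theorem exists_finite_types (hL : L.card ≤ ℵ₀) [Infinite M] {T : L.Theory} [M ⊨ T]
    (hcat : Cardinal.Categorical (ℵ₀ : Cardinal.{0}) T)
    (hsat : IsSaturated L M κ) (hκ : ℵ₀ < κ) (α : Type*) [Finite α] :
    ∃ s : Finset (α → M), ∀ x : α → M, ∃ b ∈ s, SameType L x b := by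
  choose D hD hbD h using fun b : α → M => exists_isolating hL hcat hsat hκ b
  by_contra! hs
  -- With infinitely many types, the complements of the isolating sets would have a common point x,
  -- yet x lies in its own isolating set.
  obtain ⟨x, hx⟩ := hsat.exists_mem_of_finite hκ (B := ∅) (by simpa using aleph0_pos.trans hκ)
    (fun b => (D b)ᶜ) (fun b => (hD b).compl) (by
      intro s
      obtain ⟨x, hx⟩ := hs s
      exact ⟨x, fun b hb hxb => hx b hb (h b x hxb)⟩)
  exact hx x (hbD x)

/-- In a monster model of an `ω`-categorical theory there are finitely many orbits of finite tuples
under the automorphism group. -/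
theorem exists_finite_orbits (hL : L.card ≤ ℵ₀) [Infinite M] {T : L.Theory} [M ⊨ T]
    (hcat : Cardinal.Categorical (ℵ₀ : Cardinal.{0}) T) (hM : IsMonster L M κ)
    (α : Type w) [Finite α] :
    ∃ s : Finset (α → M), ∀ x : α → M, ∃ b ∈ s, ∃ f : M ≃[L] M, ⇑f ∘ b = x := by
  obtain ⟨s, hs⟩ := exists_finite_types hL hcat hM.saturated hM.aleph0_lt α
  refine ⟨s, fun x => ?_⟩
  obtain ⟨b, hb, h⟩ := hs x
  exact ⟨b, hb, hM.homogeneous α ((lt_aleph0_of_finite α).trans hM.aleph0_lt) b x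
    fun φ => (h φ).symm⟩

/-- In a monster model of an `ω`-categorical theory, invariant sets of finite tuples are
definable. -/
theorem definable_of_invariant (hL : L.card ≤ ℵ₀) [Infinite M] {T : L.Theory} [M ⊨ T]
    (hcat : Cardinal.Categorical (ℵ₀ : Cardinal.{0}) T) (hM : IsMonster L M κ)
    {α : Type w} [Finite α] (X : Set (α → M))
    (hX : ∀ (f : M ≃[L] M), ∀ x ∈ X, ⇑f ∘ x ∈ X) : (∅ : Set M).Definable L X := by
  classical
  obtain ⟨s, hs⟩ := exists_finite_types hL hcat hM.saturated hM.aleph0_lt α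
  choose D hD hbD h using fun b : α → M => exists_isolating hL hcat hM.saturated hM.aleph0_lt b
  have hconj {x y : α → M} (hxy : SameType L x y) (hx : x ∈ X) : y ∈ X := by
    obtain ⟨f, rfl⟩ := hM.homogeneous α ((lt_aleph0_of_finite α).trans hM.aleph0_lt) x y hxy
    exact hX f x hx
  convert! definable_biUnion_finset hD (s.filter (· ∈ X)) using 1
  ext x
  simp only [Finset.mem_filter, mem_iUnion, exists_prop]
  constructor
  · intro hx
    obtain ⟨b, hb, hxb⟩ := hs x
    obtain ⟨φ, hφ⟩ := empty_definable_iff.1 (hD b)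
    refine ⟨b, ⟨hb, hconj hxb hx⟩, ?_⟩
    have := hbD b
    rw [hφ] at this ⊢
    exact (hxb φ).2 this
  · rintro ⟨b, ⟨-, hb⟩, hx⟩
    exact hconj (fun φ => (h b x hx φ).symm) hb

/-! ### Equivalence relations invariant over a finite tuple. -/

instance automorphismGroup : Group (M ≃[L] M) where
  mul f g := f.comp g
  one := Language.Equiv.refl L M
  inv f := f.symm
  mul_assoc _ _ _ := rfl
  one_mul f := f.refl_comp
  mul_one f := f.comp_refl
  inv_mul_cancel f := f.symm_comp_self

theorem mul_comp_tuple {α : Type*} (f g : M ≃[L] M) (x : α → M) :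
    ⇑(f * g) ∘ x = ⇑f ∘ ⇑g ∘ x := rfl

theorem one_comp_tuple {α : Type*} (x : α → M) : ⇑(1 : M ≃[L] M) ∘ x = x := rfl

theorem inv_comp_tuple {α : Type*} (f : M ≃[L] M) (x : α → M) : ⇑f⁻¹ ∘ ⇑f ∘ x = x := by
  rw [← mul_comp_tuple, inv_mul_cancel, one_comp_tuple]

theorem comp_inv_tuple {α : Type*} (f : M ≃[L] M) (x : α → M) : ⇑f ∘ ⇑f⁻¹ ∘ x = x := by
  rw [← mul_comp_tuple, mul_inv_cancel, one_comp_tuple]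

/-- The equivalence relation `r` is invariant under the automorphisms fixing `c`. -/
def InvariantOver (L : FirstOrder.Language.{u, v}) {M : Type w} [L.Structure M] {α β : Type w}
    (c : β → M) (r : Setoid (α → M)) : Prop :=
  ∀ f : M ≃[L] M, ⇑f ∘ c = c → ∀ x y, r x y → r (⇑f ∘ x) (⇑f ∘ y)

/-- The conjugates of a relation, parametrized by the conjugates of `c`. -/
def conjugates (L : FirstOrder.Language.{u, v}) {M : Type w} [L.Structure M] {α β : Type w}
    (c : β → M) (r : Setoid (α → M)) : Set (α ⊕ (α ⊕ β) → M) :=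
  {z | ∃ (f : M ≃[L] M) (x y : α → M), r x y ∧ z = ⇑f ∘ Sum.elim x (Sum.elim y c)}

theorem comp_mem_conjugates {α β : Type w} (c : β → M) (r : Setoid (α → M)) (f : M ≃[L] M)
    (z : α ⊕ (α ⊕ β) → M) (hz : z ∈ conjugates L c r) : ⇑f ∘ z ∈ conjugates L c r := by
  obtain ⟨g, x, y, h, rfl⟩ := hz
  exact ⟨f * g, x, y, h, rfl⟩

/-- Invariance over c makes r the fiber at c of an `∅`-invariant set, to which
`definable_of_invariant` applies. -/
theorem InvariantOver.elim_mem_conjugates {α β : Type w} {c : β → M} {r : Setoid (α → M)}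
    (hr : InvariantOver L c r) (x y : α → M) :
    Sum.elim x (Sum.elim y c) ∈ conjugates L c r ↔ r x y := by
  constructor
  · rintro ⟨f, x', y', h, he⟩
    have hx : x = ⇑f ∘ x' := funext fun i => congrFun he (Sum.inl i)
    have hy : y = ⇑f ∘ y' := funext fun i => congrFun he (Sum.inr (Sum.inl i))
    have hc : c = ⇑f ∘ c := funext fun i => congrFun he (Sum.inr (Sum.inr i))
    rw [hx, hy]
    exact hr f hc.symm x' y' h
  · exact fun h => ⟨1, x, y, h, rfl⟩

/-- A bounded equivalence relation on finite tuples which is invariant over a finite tuple has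
finitely many classes. -/
theorem InvariantOver.finite_quotient (hL : L.card ≤ ℵ₀) [Infinite M] {T : L.Theory} [M ⊨ T]
    (hcat : Cardinal.Categorical (ℵ₀ : Cardinal.{0}) T) (hM : IsMonster L M κ)
    {α β : Type w} [Finite α] [Finite β] {c : β → M}
    {r : Setoid (α → M)} (hr : InvariantOver L c r) (hκ : #(Quotient r) < κ) :
    Finite (Quotient r) := by
  by_contra hinf
  rw [not_finite_iff_infinite] at hinf
  let g : β ⊕ Quotient r × α → M := Sum.elim c fun p => p.1.out p.2
  have hfin (γ : Type w) [Finite γ] : #γ < κ := (lt_aleph0_of_finite γ).trans hM.aleph0_lt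
  have hB : #(range g) < κ := mk_range_le.trans_lt (by
    rw [mk_sum, mk_prod]
    simpa using add_lt_of_lt hM.aleph0_lt.le (hfin β)
      (mul_lt_of_lt hM.aleph0_lt.le hκ (hfin α)))
  -- Infinitely but fewer than κ many classes: saturation over their representatives would give a
  -- point outside all of them.
  obtain ⟨x, hx⟩ := hM.saturated.exists_mem_of_finite hM.aleph0_lt hB
    (fun q : Quotient r => {x | r x q.out}ᶜ) (by
      intro q
      refine Definable.compl ?_
      have h := definable_fiber (definable_of_invariant hL hcat hM (conjugates L c r)
        (comp_mem_conjugates c r)) (empty_subset (range g)) (Sum.elim q.out c) (by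
          rintro _ ⟨i | i, rfl⟩
          · exact ⟨Sum.inr (q, i), rfl⟩
          · exact ⟨Sum.inl i, rfl⟩)
      simpa only [hr.elim_mem_conjugates] using h) (by
      intro s
      obtain ⟨q, hq⟩ := Infinite.exists_notMem_finset s
      refine ⟨q.out, fun q' hq' h => hq ?_⟩
      have : (⟦q.out⟧ : Quotient r) = ⟦q'.out⟧ := Quotient.sound h
      rw [q.out_eq, q'.out_eq] at this
      rwa [this])
  exact hx ⟦x⟧ (Setoid.symm (Quotient.mk_out x))

/-- There are finitely many equivalence relations on finite tuples of a given length which are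
invariant over a given finite tuple. -/
theorem finite_setOf_invariantOver (hL : L.card ≤ ℵ₀) [Infinite M] {T : L.Theory} [M ⊨ T]
    (hcat : Cardinal.Categorical (ℵ₀ : Cardinal.{0}) T) (hM : IsMonster L M κ)
    (α : Type w) {β : Type w} [Finite α] [Finite β] (c : β → M) :
    {r : Setoid (α → M) | InvariantOver L c r}.Finite := by
  obtain ⟨s, hs⟩ := exists_finite_orbits hL hcat hM (α ⊕ (α ⊕ β))
  -- A relation is determined by which of the finitely many orbits lie in its set of conjugates.
  refine Set.Finite.of_finite_image
    (f := fun r => (fun b : s => (b : α ⊕ (α ⊕ β) → M) ∈ conjugates L c r)) (toFinite _) ?_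
  have key {r r' : Setoid (α → M)} (hr : InvariantOver L c r) (hr' : InvariantOver L c r')
      (h : ∀ b : s, (b : α ⊕ (α ⊕ β) → M) ∈ conjugates L c r →
        (b : α ⊕ (α ⊕ β) → M) ∈ conjugates L c r') (x y : α → M) (hxy : r x y) : r' x y := by
    obtain ⟨b, hb, f, hf⟩ := hs (Sum.elim x (Sum.elim y c))
    rw [← hr'.elim_mem_conjugates, ← hf]
    refine comp_mem_conjugates c r' f b (h ⟨b, hb⟩ ?_)
    have := comp_mem_conjugates c r f⁻¹ _ ((hr.elim_mem_conjugates x y).2 hxy)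
    rwa [← hf, inv_comp_tuple] at this
  intro r hr r' hr' h
  ext x y
  have h' (b : s) := iff_of_eq (congrFun h b)
  exact ⟨key hr hr' (fun b => (h' b).1) x y, key hr' hr (fun b => (h' b).2) x y⟩

/-! ### Canonical parameters. -/

/-- Canonical parameters: a set invariant over a finite tuple has a code in `M^eq`. -/
theorem exists_imaginary_code (hL : L.card ≤ ℵ₀) [Infinite M] {T : L.Theory} [M ⊨ T]
    (hcat : Cardinal.Categorical (ℵ₀ : Cardinal.{0}) T) (hM : IsMonster L M κ)
    {α γ : Type w} [Finite γ] (X : Set (α → M)) (d : γ → M)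
    (hd : ∀ f : M ≃[L] M, ⇑f ∘ d = d → ∀ x, x ∈ X ↔ ⇑f ∘ x ∈ X) :
    ∃ e : Hyperimaginary L M κ, e.IsImaginary ∧
      ∀ f, e.FixedBy f ↔ ∀ x, x ∈ X ↔ ⇑f ∘ x ∈ X := by
  -- `K g` is the translate gX. It depends only on gd, so on the orbit of d the relation `R` below
  -- compares translates; off the orbit it is equality.
  let K (g : M ≃[L] M) : Set (α → M) := {x | ⇑g⁻¹ ∘ x ∈ X}
  have hK1 : K 1 = X := by
    ext x
    change ⇑(1⁻¹ : M ≃[L] M) ∘ x ∈ X ↔ x ∈ X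
    rw [inv_one, one_comp_tuple]
  have hK (f g : M ≃[L] M) : K (f * g) = {x | ⇑f⁻¹ ∘ x ∈ K g} := by
    ext x
    change ⇑(f * g)⁻¹ ∘ x ∈ X ↔ ⇑g⁻¹ ∘ ⇑f⁻¹ ∘ x ∈ X
    rw [mul_inv_rev, mul_comp_tuple]
  have hKX (f : M ≃[L] M) : K f = X ↔ ∀ x, x ∈ X ↔ ⇑f ∘ x ∈ X := by
    constructor
    · intro h x
      rw [← h]
      change _ ↔ ⇑f⁻¹ ∘ ⇑f ∘ x ∈ X
      rw [inv_comp_tuple, h]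
    · intro h
      ext x
      change ⇑f⁻¹ ∘ x ∈ X ↔ _
      rw [h, comp_inv_tuple]
  have hKd (g g' : M ≃[L] M) (h : ⇑g ∘ d = ⇑g' ∘ d) : K g = K g' := by
    have h1 : K (g'⁻¹ * g) = X := (hKX _).2 (hd _ (by rw [mul_comp_tuple, h, inv_comp_tuple]))
    have h2 := hK g' (g'⁻¹ * g)
    rw [mul_inv_cancel_left, h1] at h2
    exact h2
  let R : Setoid (γ → M) :=
    { r := fun u v => u = v ∨ ∃ g g' : M ≃[L] M, u = ⇑g ∘ d ∧ v = ⇑g' ∘ d ∧ K g = K g'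
      iseqv := by
        refine ⟨fun u => Or.inl rfl, ?_, ?_⟩
        · rintro u v (rfl | ⟨g, g', h, h', hg⟩)
          · exact Or.inl rfl
          · exact Or.inr ⟨g', g, h', h, hg.symm⟩
        · rintro u v w (rfl | ⟨g, g', h, h', hg⟩) (rfl | ⟨k, k', hk, hk', hkk⟩)
          · exact Or.inl rfl
          · exact Or.inr ⟨k, k', hk, hk', hkk⟩
          · exact Or.inr ⟨g, g', h, h', hg⟩
          · exact Or.inr ⟨g, k', h, hk', hg.trans ((hKd _ _ (h'.symm.trans hk)).trans hkk)⟩ }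
  have hR : (∅ : Set M).Definable L (pairSet R.r) := by
    refine definable_of_invariant hL hcat hM _ ?_
    rintro f z (h | ⟨g, g', h, h', hg⟩)
    · exact Or.inl (congrArg (⇑f ∘ ·) h)
    · exact Or.inr ⟨f * g, f * g', congrArg (⇑f ∘ ·) h, congrArg (⇑f ∘ ·) h', by
        rw [hK, hK, hg]⟩
  obtain ⟨φ, hφ⟩ := empty_definable_iff.1 hR
  let S : HyperSort L M κ :=
    { ι := γ
      small := (lt_aleph0_of_finite γ).trans hM.aleph0_lt
      rel := R
      typeDefinable := ⟨{φ}, by rw [hφ]; ext z; simp⟩ }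
  refine ⟨⟨S, ⟦d⟧⟩, ⟨inferInstanceAs (Finite γ), hR⟩, fun f => ?_⟩
  rw [← hKX]
  have hfix : (⟨S, ⟦d⟧⟩ : Hyperimaginary L M κ).FixedBy f ↔ R.r (⇑f ∘ d) d :=
    Quotient.eq (r := R)
  rw [hfix]
  constructor
  · rintro (h | ⟨g, g', h, h', hg⟩)
    · exact (hKX f).2 (hd f h)
    · rw [hKd f g h, hg, hKd g' 1 h'.symm, hK1]
  · exact fun h => Or.inr ⟨f, 1, rfl, rfl, h.trans hK1.symm⟩

/-! ### Small index and bounded closure. -/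

/-- The subgroup `P ⊓ Q` has small index in `P`: the elements of `P` can be coloured with fewer than
`κ` colours such that elements of the same colour are in the same left coset of `Q`. -/
def SmallIndex {G : Type*} [Group G] (κ : Cardinal.{w}) (P Q : Subgroup G) : Prop :=
  ∃ (C : Type w) (col : G → C), #C < κ ∧ ∀ f ∈ P, ∀ g ∈ P, col f = col g → f⁻¹ * g ∈ Q

namespace SmallIndex

variable {G : Type*} [Group G] {P Q R : Subgroup G}

theorem of_le (hκ : ℵ₀ < κ) (h : P ≤ Q) : SmallIndex κ P Q :=
  ⟨PUnit, fun _ => PUnit.unit, by simpa using one_lt_aleph0.trans hκ,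
    fun _ hf _ hg _ => h (P.mul_mem (P.inv_mem hf) hg)⟩

theorem inf (hκ : ℵ₀ < κ) (hQ : SmallIndex κ P Q) (hR : SmallIndex κ P R) :
    SmallIndex κ P (Q ⊓ R) := by
  obtain ⟨C, col, hC, h⟩ := hQ
  obtain ⟨D, col', hD, h'⟩ := hR
  refine ⟨C × D, fun f => (col f, col' f), ?_, fun f hf g hg hfg => ?_⟩
  · rw [mk_prod, lift_id, lift_id]
    exact mul_lt_of_lt hκ.le hC hD
  · rw [Prod.mk.injEq] at hfg
    exact ⟨h f hf g hg hfg.1, h' f hf g hg hfg.2⟩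

theorem trans (hκ : ℵ₀ < κ) (hQ : SmallIndex κ P Q) (hR : SmallIndex κ Q R) :
    SmallIndex κ P R := by
  classical
  obtain ⟨C, col, hC, h⟩ := hQ
  obtain ⟨D, col', hD, h'⟩ := hR
  -- A representative in P of each colour; the default 1, for colours not met by P, is never used.
  -- The new colour of f also records the colour of `(rep (col f))⁻¹ * f`, which lies in Q.
  let rep (t : C) : G := if ht : ∃ g ∈ P, col g = t then ht.choose else 1
  have hrep (g : G) (hg : g ∈ P) : rep (col g) ∈ P ∧ col (rep (col g)) = col g := by
    have ht : ∃ g' ∈ P, col g' = col g := ⟨g, hg, rfl⟩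
    simp only [rep, dif_pos ht]
    exact ht.choose_spec
  refine ⟨C × D, fun f => (col f, col' ((rep (col f))⁻¹ * f)), ?_, fun f hf g hg hfg => ?_⟩
  · rw [mk_prod, lift_id, lift_id]
    exact mul_lt_of_lt hκ.le hC hD
  · rw [Prod.mk.injEq] at hfg
    obtain ⟨h1, h2⟩ := hfg
    rw [← h1] at h2
    have hf' := h _ (hrep f hf).1 f hf (hrep f hf).2
    have hg' := h _ (hrep f hf).1 g hg ((hrep f hf).2.trans h1)
    simpa [mul_assoc] using h' _ hf' _ hg' h2

/-- If every element of `P` is the product of an element of `Q` and an element of `R`, then `R` is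
of small index in `P` if it is so in `Q`. -/
theorem of_factorization (hQ : SmallIndex κ Q R) (h : ∀ g ∈ P, ∃ k ∈ R, g * k ∈ Q) :
    SmallIndex κ P R := by
  obtain ⟨C, col, hC, hcol⟩ := hQ
  choose! k hk hkQ using h
  refine ⟨C, fun g => col (g * k g), hC, fun f hf g hg hfg => ?_⟩
  -- f⁻¹g = k_f · ((f k_f)⁻¹(g k_g)) · k_g⁻¹, a product of three elements of R.
  have := hcol _ (hkQ f hf) _ (hkQ g hg) hfg
  have := R.mul_mem (R.mul_mem (hk f hf) this) (R.inv_mem (hk g hg))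
  simpa [mul_assoc] using this

end SmallIndex

theorem HyperSort.act_mul (S : HyperSort L M κ) (f g : M ≃[L] M) (q : Quotient S.rel) :
    S.act (f * g) q = S.act f (S.act g q) := by
  induction q using Quotient.inductionOn with
  | h x => rfl

theorem HyperSort.act_one (S : HyperSort L M κ) (q : Quotient S.rel) : S.act 1 q = q := by
  induction q using Quotient.inductionOn with
  | h x => rfl

theorem HyperSort.act_inv_eq_iff (S : HyperSort L M κ) (f : M ≃[L] M) (p q : Quotient S.rel) :
    S.act f⁻¹ p = q ↔ p = S.act f q := by
  constructor
  · rintro rfl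
    rw [← S.act_mul, mul_inv_cancel, S.act_one]
  · rintro rfl
    rw [← S.act_mul, inv_mul_cancel, S.act_one]

/-- The group of automorphisms fixing every element of `A`. -/
def fixer (A : Set (Hyperimaginary L M κ)) : Subgroup (M ≃[L] M) where
  carrier := {f | ∀ x ∈ A, x.FixedBy f}
  one_mem' := fun x _ => x.sort.act_one _
  mul_mem' := fun {f g} hf hg x hx => by
    have h1 : x.sort.act f x.cls = x.cls := hf x hx
    have h2 : x.sort.act g x.cls = x.cls := hg x hx
    change x.sort.act (f * g) x.cls = x.cls
    rw [x.sort.act_mul, h2, h1]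
  inv_mem' := fun {f} hf x hx => (x.sort.act_inv_eq_iff _ _ _).2 (Eq.symm (hf x hx))

theorem mem_fixer {A : Set (Hyperimaginary L M κ)} {f : M ≃[L] M} :
    f ∈ fixer A ↔ ∀ x ∈ A, x.FixedBy f := Iff.rfl

theorem mem_fixer_singleton {h : Hyperimaginary L M κ} {f : M ≃[L] M} :
    f ∈ fixer {h} ↔ h.FixedBy f := by
  simp [mem_fixer]

theorem fixer_anti {A B : Set (Hyperimaginary L M κ)} (h : A ⊆ B) : fixer B ≤ fixer A :=
  fun _ hf x hx => hf x (h hx)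

theorem inv_mul_mem_fixer_singleton {h : Hyperimaginary L M κ} {f g : M ≃[L] M} :
    f⁻¹ * g ∈ fixer {h} ↔ h.sort.act f h.cls = h.sort.act g h.cls := by
  rw [mem_fixer_singleton, Hyperimaginary.FixedBy, h.sort.act_mul, h.sort.act_inv_eq_iff, eq_comm]

/-- Orbit–stabilizer: points of the orbit of h correspond to left cosets of the stabilizer. Bounded
closure thereby becomes a matter of subgroups. -/
theorem mem_bdd_iff {A : Set (Hyperimaginary L M κ)} {h : Hyperimaginary L M κ} :
    h ∈ bdd A ↔ SmallIndex κ (fixer A) (fixer {h}) := by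
  constructor
  · intro hh
    classical
    refine ⟨h.orbit A, fun f => if hf : f ∈ fixer A then ⟨h.sort.act f h.cls, f, hf, rfl⟩ else
      ⟨h.cls, 1, (fixer A).one_mem, h.sort.act_one _⟩, hh, fun f hf g hg hfg => ?_⟩
    simp only [dif_pos hf, dif_pos hg] at hfg
    exact inv_mul_mem_fixer_singleton.2 (congrArg Subtype.val hfg)
  · rintro ⟨C, col, hC, hcol⟩
    refine (mk_le_of_injective (f := fun c : h.orbit A => col c.2.choose) ?_).trans_lt hC
    intro c c' hcc
    have := hcol _ c.2.choose_spec.1 _ c'.2.choose_spec.1 hcc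
    rw [inv_mul_mem_fixer_singleton, c.2.choose_spec.2, c'.2.choose_spec.2] at this
    exact Subtype.ext this

theorem smallIndex_fixer_of_finite (hκ : ℵ₀ < κ) {A B : Set (Hyperimaginary L M κ)}
    (hB : B.Finite) (hBA : B ⊆ bdd A) : SmallIndex κ (fixer A) (fixer B) := by
  induction B, hB using Set.Finite.induction_on with
  | empty => exact SmallIndex.of_le hκ fun f _ x hx => hx.elim
  | @insert b B _ _ ih =>
    rw [insert_subset_iff] at hBA
    have : fixer (insert b B) = fixer {b} ⊓ fixer B := by
      ext f
      simp [mem_fixer]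
    rw [this]
    exact SmallIndex.inf hκ (mem_bdd_iff.1 hBA.1) (ih hBA.2)

/-- The hyperimaginaries bounded over `e` are bounded over `A` if `e` is. -/
theorem bdd_subset_of_mem (hκ : ℵ₀ < κ) {A : Set (Hyperimaginary L M κ)}
    {e : Hyperimaginary L M κ} (he : e ∈ bdd A) : bdd {e} ⊆ bdd A := fun _ hh =>
  mem_bdd_iff.2 ((mem_bdd_iff.1 he).trans hκ (mem_bdd_iff.1 hh))

/-! ### Conjugates of a over finite subsets of bdd(a). -/

/-- The tuples representing the conjugates of the tuple `a` over `B`. -/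
def conjTuples {n : ℕ} (a : Fin n → Hyperimaginary L M κ) (B : Set (Hyperimaginary L M κ)) :
    Set ((Σ i, (a i).sort.ι) → M) :=
  {x | ∃ g ∈ fixer B, ∀ i, (⟦fun j => x ⟨i, j⟩⟧ : Quotient (a i).sort.rel) =
    (a i).sort.act g (a i).cls}

variable {n : ℕ} {a : Fin n → Hyperimaginary L M κ} {B : Set (Hyperimaginary L M κ)}

theorem comp_mem_conjTuples {f : M ≃[L] M} (hf : f ∈ fixer B)
    {x : (Σ i, (a i).sort.ι) → M} (hx : x ∈ conjTuples a B) : ⇑f ∘ x ∈ conjTuples a B := by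
  obtain ⟨g, hg, h⟩ := hx
  refine ⟨f * g, (fixer B).mul_mem hf hg, fun i => ?_⟩
  rw [(a i).sort.act_mul, ← h]
  rfl

theorem comp_mem_conjTuples_iff {f : M ≃[L] M} (hf : f ∈ fixer B)
    (x : (Σ i, (a i).sort.ι) → M) : x ∈ conjTuples a B ↔ ⇑f ∘ x ∈ conjTuples a B := by
  refine ⟨comp_mem_conjTuples hf, fun h => ?_⟩
  rw [← inv_comp_tuple f x]
  exact comp_mem_conjTuples ((fixer B).inv_mem hf) h

theorem conjTuples_anti {B' : Set (Hyperimaginary L M κ)} (h : B ⊆ B') :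
    conjTuples a B' ⊆ conjTuples a B := fun _ ⟨g, hg, hx⟩ => ⟨g, fixer_anti h hg, hx⟩

/-- A tuple representing the tuple `a`. -/
noncomputable def repTuple (a : Fin n → Hyperimaginary L M κ) : (Σ i, (a i).sort.ι) → M :=
  fun p => (a p.1).cls.out p.2

theorem mk_repTuple (i : Fin n) :
    (⟦fun j => repTuple a ⟨i, j⟩⟧ : Quotient (a i).sort.rel) = (a i).cls :=
  (a i).cls.out_eq

theorem mk_comp_repTuple (f : M ≃[L] M) (i : Fin n) :
    (⟦fun j => (⇑f ∘ repTuple a) ⟨i, j⟩⟧ : Quotient (a i).sort.rel) =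
      (a i).sort.act f (a i).cls := by
  conv_rhs => rw [← mk_repTuple i]
  rfl

theorem repTuple_mem_conjTuples : repTuple a ∈ conjTuples a B :=
  ⟨1, (fixer B).one_mem, fun i => by rw [mk_repTuple, (a i).sort.act_one]⟩

theorem mem_fixer_of_comp_repTuple {f : M ≃[L] M} (hf : ⇑f ∘ repTuple a = repTuple a) :
    f ∈ fixer (range a) := by
  rintro _ ⟨i, rfl⟩
  have := mk_comp_repTuple (a := a) f i
  rw [hf, mk_repTuple] at this
  exact this.symm

/-- Two tuples are equivalent if they are in the same conjugates of `conjTuples a B` under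
the automorphisms fixing `repTuple a`. -/
def conjSetoid (a : Fin n → Hyperimaginary L M κ) (B : Set (Hyperimaginary L M κ)) :
    Setoid ((Σ i, (a i).sort.ι) → M) where
  r x y := ∀ g : M ≃[L] M, ⇑g ∘ repTuple a = repTuple a →
    (⇑g ∘ x ∈ conjTuples a B ↔ ⇑g ∘ y ∈ conjTuples a B)
  iseqv := ⟨fun _ _ _ => Iff.rfl, fun h g hg => (h g hg).symm,
    fun h h' g hg => (h g hg).trans (h' g hg)⟩

theorem invariantOver_conjSetoid : InvariantOver L (repTuple a) (conjSetoid a B) :=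
  fun f hf _ _ h g hg => h (g * f) (by rw [mul_comp_tuple, hf, hg])

theorem conjSetoid_mem_iff {x y : (Σ i, (a i).sort.ι) → M} (h : conjSetoid a B x y) :
    x ∈ conjTuples a B ↔ y ∈ conjTuples a B :=
  h 1 rfl

/-- The class of x is determined by which g fixing `repTuple a` send x into `conjTuples a B`. This
depends only on the coset of g⁻¹ modulo `fixer B`, hence on its colour, so there are at most 2^|C|
classes; κ is a strong limit. -/
theorem mk_quotient_conjSetoid_lt (hκ : κ.IsStrongLimit)
    (hB : SmallIndex κ (fixer (range a)) (fixer B)) : #(Quotient (conjSetoid a B)) < κ := by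
  obtain ⟨C, col, hC, hcol⟩ := hB
  let F (x : (Σ i, (a i).sort.ι) → M) : Set C :=
    {t | ∃ g : M ≃[L] M, ⇑g ∘ repTuple a = repTuple a ∧ col g⁻¹ = t ∧ ⇑g ∘ x ∈ conjTuples a B}
  have hF {x y : (Σ i, (a i).sort.ι) → M} (h : F x = F y) (g : M ≃[L] M)
      (hg : ⇑g ∘ repTuple a = repTuple a) (hx : ⇑g ∘ x ∈ conjTuples a B) :
      ⇑g ∘ y ∈ conjTuples a B := by
    have : col g⁻¹ ∈ F x := ⟨g, hg, rfl, hx⟩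
    rw [h] at this
    obtain ⟨g', hg', hc, hy⟩ := this
    have h1 := hcol _ ((fixer _).inv_mem (mem_fixer_of_comp_repTuple hg)) _
      ((fixer _).inv_mem (mem_fixer_of_comp_repTuple hg')) hc.symm
    rw [inv_inv] at h1
    have := comp_mem_conjTuples h1 hy
    rwa [mul_comp_tuple, inv_comp_tuple] at this
  have hinj : Function.Injective fun q : Quotient (conjSetoid a B) => F q.out := by
    intro q q' h
    rw [← q.out_eq, ← q'.out_eq]
    exact Quotient.sound fun g hg => ⟨hF h g hg, hF h.symm g hg⟩
  refine (mk_le_of_injective hinj).trans_lt ?_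
  rw [mk_set]
  exact hκ.isStrongPrelimit hC

/-- There are finitely many sets which are unions of classes of one of finitely many
equivalence relations with finitely many classes. -/
theorem finite_setOf_saturated {X : Type*} {𝓡 : Set (Setoid X)} (h𝓡 : 𝓡.Finite)
    (hfin : ∀ r ∈ 𝓡, Finite (Quotient r)) :
    {Y : Set X | ∃ r ∈ 𝓡, ∀ x y, r x y → x ∈ Y → y ∈ Y}.Finite := by
  have : {Y : Set X | ∃ r ∈ 𝓡, ∀ x y, r x y → x ∈ Y → y ∈ Y} =
      ⋃ r ∈ 𝓡, {Y : Set X | ∀ x y, r x y → x ∈ Y → y ∈ Y} := by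
    ext Y
    simp
  rw [this]
  refine h𝓡.biUnion fun r hr => ?_
  have := hfin r hr
  refine Set.Finite.of_finite_image (f := fun Y : Set X => (Quotient.mk r) '' Y) (toFinite _) ?_
  intro Y hY Z hZ h
  have key {Y Z : Set X} (hZ : ∀ x y, r x y → x ∈ Z → y ∈ Z)
      (h : Quotient.mk r '' Y = Quotient.mk r '' Z) : Y ⊆ Z := by
    intro x hx
    obtain ⟨z, hz, hzx⟩ := h.subset ⟨x, hx, rfl⟩
    exact hZ z x (Quotient.exact hzx) hz
  exact (key hZ h).antisymm (key hY h.symm)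

/-- Among the sets `conjTuples a B` for finite `B ⊆ C`, where `C ⊆ bdd a`, there is a least one. -/
theorem exists_least_conjTuples (hL : L.card ≤ ℵ₀) [Infinite M] {T : L.Theory} [M ⊨ T]
    (hcat : Cardinal.Categorical (ℵ₀ : Cardinal.{0}) T) (hM : IsMonster L M κ)
    {n : ℕ} (a : Fin n → Hyperimaginary L M κ) (ha : ∀ i, (a i).IsImaginary)
    (C : Set (Hyperimaginary L M κ)) (hC : C ⊆ bdd (range a)) :
    ∃ B ⊆ C, B.Finite ∧ Finite (Quotient (conjSetoid a B)) ∧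
      ∀ h ∈ C, conjTuples a B ⊆ conjTuples a {h} := by
  have (i : Fin n) : Finite (a i).sort.ι := (ha i).1
  have hquot {B : Set (Hyperimaginary L M κ)} (hB : B.Finite) (hBC : B ⊆ C) :
      Finite (Quotient (conjSetoid a B)) :=
    invariantOver_conjSetoid.finite_quotient hL hcat hM (mk_quotient_conjSetoid_lt
      hM.isStrongLimit (smallIndex_fixer_of_finite hM.aleph0_lt hB (hBC.trans hC)))
  let 𝓑 : Set (Set (Hyperimaginary L M κ)) := {B | B.Finite ∧ B ⊆ C}
  have h𝓡 : (conjSetoid a '' 𝓑).Finite :=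
    (finite_setOf_invariantOver hL hcat hM _ (repTuple a)).subset (by
      rintro _ ⟨B, -, rfl⟩
      exact invariantOver_conjSetoid)
  have hfin : (conjTuples a '' 𝓑).Finite := by
    refine (finite_setOf_saturated h𝓡 ?_).subset ?_
    · rintro _ ⟨B, hB, rfl⟩
      exact hquot hB.1 hB.2
    · rintro _ ⟨B, hB, rfl⟩
      exact ⟨_, ⟨B, hB, rfl⟩, fun x y h => (conjSetoid_mem_iff h).1⟩
  obtain ⟨_, hmin⟩ := hfin.exists_minimal ⟨_, ∅, ⟨finite_empty, empty_subset C⟩, rfl⟩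
  obtain ⟨B, ⟨hB, hBC⟩, rfl⟩ := hmin.1
  refine ⟨B, hBC, hB, hquot hB hBC, fun h hh => ?_⟩
  -- Adjoining h cannot shrink the minimal set, which therefore lies in `conjTuples a {h}`.
  have hle : conjTuples a (insert h B) ⊆ conjTuples a B := conjTuples_anti (subset_insert h B)
  have hins : insert h B ∈ 𝓑 := ⟨hB.insert h, insert_subset hh hBC⟩
  exact (hmin.2 ⟨_, hins, rfl⟩ hle).trans
    (conjTuples_anti (singleton_subset_iff.2 (mem_insert h B)))

end BddClosure

/-! ### The main theorem. -/

theorem mainTheorem5 (L : FirstOrder.Language.{u, v}) (hL : L.card ≤ Cardinal.aleph0)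
    (T : L.Theory) (hT : T.IsComplete)
    (hcat : Cardinal.Categorical (Cardinal.aleph0 : Cardinal.{0}) T)
    (M : Type w) [L.Structure M] [M ⊨ T] [Infinite M]
    (κ : Cardinal.{w}) (hM : BddClosure.IsMonster L M κ)
    (n : ℕ) (a : Fin n → BddClosure.Hyperimaginary L M κ) (ha : ∀ i, (a i).IsImaginary)
    (A : Set (BddClosure.Hyperimaginary L M κ))
    (hA : Cardinal.mk A < Cardinal.lift.{w + 1} κ) :
    ∃ e : BddClosure.Hyperimaginary L M κ, e.IsImaginary ∧
      BddClosure.bdd {e} = BddClosure.bdd (Set.range a) ∩ BddClosure.bdd A := by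
  open BddClosure in
  have (i : Fin n) : Finite (a i).sort.ι := (ha i).1
  have hκ := hM.aleph0_lt
  obtain ⟨B, hBC, hB, hfin, hleast⟩ := exists_least_conjTuples hL hcat hM a ha
    (bdd (Set.range a) ∩ bdd A) Set.inter_subset_left
  let r := conjSetoid a B
  -- A finite tuple: a representative of a and one of each class of r. An automorphism fixing it
  -- fixes every class of r, hence the union `conjTuples a B` of classes.
  let d : (Σ i, (a i).sort.ι) ⊕ Quotient r × (Σ i, (a i).sort.ι) → M :=
    Sum.elim (repTuple a) fun p => p.1.out p.2
  have hd (f : M ≃[L] M) (hf : ⇑f ∘ d = d) (x : (Σ i, (a i).sort.ι) → M) :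
      x ∈ conjTuples a B ↔ ⇑f ∘ x ∈ conjTuples a B := by
    have hc : ⇑f ∘ repTuple a = repTuple a := funext fun i => congrFun hf (Sum.inl i)
    have hout (q : Quotient r) : ⇑f ∘ q.out = q.out :=
      funext fun i => congrFun hf (Sum.inr (q, i))
    have hx : r (Quotient.out ⟦x⟧) x := Quotient.mk_out x
    have hfx := invariantOver_conjSetoid f hc _ _ hx
    rw [hout] at hfx
    exact (conjSetoid_mem_iff hx).symm.trans (conjSetoid_mem_iff hfx)
  obtain ⟨e, he, hfix⟩ := exists_imaginary_code hL hcat hM (conjTuples a B) d hd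
  have hBe : fixer B ≤ fixer {e} := fun f hf =>
    mem_fixer_singleton.2 ((hfix f).2 (comp_mem_conjTuples_iff hf))
  have hmem {A' : Set (Hyperimaginary L M κ)} (h : B ⊆ bdd A') : e ∈ bdd A' :=
    mem_bdd_iff.2 ((smallIndex_fixer_of_finite hκ hB h).trans hκ (SmallIndex.of_le hκ hBe))
  refine ⟨e, he, Set.Subset.antisymm (Set.subset_inter
    (bdd_subset_of_mem hκ (hmem (hBC.trans Set.inter_subset_left)))
    (bdd_subset_of_mem hκ (hmem (hBC.trans Set.inter_subset_right)))) fun h hh => ?_⟩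
  -- As h is bounded over a, it suffices to correct each g fixing e by some k fixing h so that gk
  -- fixes a.
  refine mem_bdd_iff.2 ((mem_bdd_iff.1 hh.1).of_factorization fun g hg => ?_)
  have hg' := (hfix _).1 (mem_fixer_singleton.1 ((fixer {e}).inv_mem hg))
  obtain ⟨k, hk, hgk⟩ := hleast h hh ((hg' (repTuple a)).1 repTuple_mem_conjTuples)
  refine ⟨k, hk, ?_⟩
  rintro _ ⟨i, rfl⟩
  have := hgk i
  rw [mk_comp_repTuple, (a i).sort.act_inv_eq_iff, ← (a i).sort.act_mul] at this
  exact this.symm
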